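/- Let $\mathbb{P}^2$ be the real projective plane, whose points are the lines through the origin in $\mathbb{R}^3$. For $P,Q\in\mathbb{P}^2$ let $\varphi_{PQ}\in[0^\circ,90^\circ]$ be the smallest angle between the lines $P$ and $Q$, and let $d(P,Q)=\sin\varphi_{PQ}$. Let $A,B,C\in\mathbb{P}^2$ be non-collinear points, ordered so that $\varphi_{AB}\le\varphi_{AC}\le\varphi_{BC}$, and let $\mathscr{P}_{ABC}\subset\mathbb{P}^2$ be the set of all global minimizers over $P\in\mathbb{P}^2$ of $d(A,P)+d(B,P)+d(C,P)$. 1. If $60^\circ\le\varphi_{AB}\le\varphi_{AC}<\varphi_{BC}$, then $\mathscr{P}_{ABC}=\{A\}$. 2. If $60^\circ\le\varphi_{AB}<\varphi_{AC}=\varphi_{BC}$, then $\mathscr{P}_{ABC}=\{A,B\}$. 3. If $\varphi_{AB}=\varphi_{AC}=\varphi_{BC}=\varphi$, then there are unit vectors $a,b,c\in\mathbb{R}^3$ spanning the lines $A,B,C$ such that $a^\top b=a^\top c=b^\top c$ and $a+b+c\ne0$. For any such choice let $E\in\mathbb{P}^2$ be the line spanned by $a+b+c$ (the centroid of the three equiangular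 lines). Then: (a) if $\varphi>60^\circ$, then $\mathscr{P}_{ABC}=\{A,B,C\}$; (b) if $\varphi=60^\circ$, then $\mathscr{P}_{ABC}=\{A,B,C,E\}$; (c) if $\varphi<60^\circ$, then $\mathscr{P}_{ABC}=\{E\}$. -/

import Mathlib

open scoped LinearAlgebra.Projectivization

/-- The real projective plane: lines through the origin of Euclidean `ℝ³`. -/
abbrev ProjPlane : Type := ℙ ℝ (EuclideanSpace ℝ (Fin 3))

/-- The smallest angle between the lines of `ℝ³` represented by `P` and `Q`: two vectors spanning
these lines make an angle `θ` or `π - θ`, according to the choice of their directions, and the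
smaller of the two is taken. -/
noncomputable def lineAngle (P Q : ProjPlane) : ℝ :=
  min (InnerProductGeometry.angle P.rep Q.rep) (InnerProductGeometry.angle P.rep (-Q.rep))

/-- The smallest angle does not depend on the vectors chosen to represent the lines. -/
theorem lineAngle_mk (v w : EuclideanSpace ℝ (Fin 3)) (hv : v ≠ 0) (hw : w ≠ 0) :
    lineAngle (Projectivization.mk ℝ v hv) (Projectivization.mk ℝ w hw) =
      min (InnerProductGeometry.angle v w) (InnerProductGeometry.angle v (-w)) := by
  unfold lineAngle
  obtain ⟨s, hs⟩ := Projectivization.exists_smul_eq_mk_rep ℝ v hv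
  obtain ⟨t, ht⟩ := Projectivization.exists_smul_eq_mk_rep ℝ w hw
  rw [← hs, ← ht, Units.smul_def, Units.smul_def]
  rcases lt_or_gt_of_ne s.ne_zero with h | h <;> rcases lt_or_gt_of_ne t.ne_zero with h' | h' <;>
    simp [← smul_neg, InnerProductGeometry.angle_smul_left_of_neg,
      InnerProductGeometry.angle_smul_right_of_neg, InnerProductGeometry.angle_smul_left_of_pos,
      InnerProductGeometry.angle_smul_right_of_pos, InnerProductGeometry.angle_neg_left,
      InnerProductGeometry.angle_neg_right, h, h', min_comm]

/-- The sine distance on the projective plane. -/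
noncomputable def sineDist (P Q : ProjPlane) : ℝ := Real.sin (lineAngle P Q)

/-- The sum of the sine distances from the vertices `A`, `B`, `C` to the point `P`. -/
noncomputable def sumDist (A B C P : ProjPlane) : ℝ :=
  sineDist A P + sineDist B P + sineDist C P

/-- The Fermat-Torricelli points of `A`, `B`, `C`: the global minimizers of the sum of the sine
distances. -/
def fermatTorricelli (A B C : ProjPlane) : Set ProjPlane :=
  {P | IsMinOn (sumDist A B C) Set.univ P}

/-- `E` is the centroid of the equiangular lines `A`, `B`, `C`: these lines are spanned by unit
vectors `a`, `b`, `c` with equal pairwise inner products, and `E` is spanned by `a + b + c`. -/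
def IsCentroidLine (A B C E : ProjPlane) : Prop :=
  ∃ (a b c : EuclideanSpace ℝ (Fin 3)) (ha : a ≠ 0) (hb : b ≠ 0) (hc : c ≠ 0)
    (he : a + b + c ≠ 0),
    ‖a‖ = 1 ∧ ‖b‖ = 1 ∧ ‖c‖ = 1 ∧
    inner ℝ a b = inner ℝ a c ∧ inner ℝ a c = inner ℝ b c ∧
    A = Projectivization.mk ℝ a ha ∧ B = Projectivization.mk ℝ b hb ∧
    C = Projectivization.mk ℝ c hc ∧ E = Projectivization.mk ℝ (a + b + c) he

/-! Let `p` be a unit vector at distances `x`, `y`, `z` from the lines of unit vectors `a`, `b`,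
`c`. Put `u₁ = ⟪a, p⟫ / x` and similarly `u₂`, `u₃`. Then `q = u₁ a + u₂ b + u₃ c` satisfies `⟪q, p⟫
= K`, where `K = 1/x + 1/y + 1/z - (x + y + z) = x u₁² + y u₂² + z u₃²`. Cauchy–Schwarz, `K² ≤
‖q‖²`, becomes homogeneous quadratic in `u` once one factor `K` is replaced by the last sum:
`distForm` is nonpositive at `(|u₁|, |u₂|, |u₃|)` (`distForm_le_of_unit`).

Hence if `distForm` is positive definite whenever the distances add up to the conjectured minimum
`F`, no point off the vertices has sum at most `F`; smaller sums are scaled up to `F`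
(`eq_of_add_dist_le`).

Definiteness reduces to the sign of a determinant. For fixed `z` and `x + y` this is a concave
quadratic in `x * y`, so only the endpoints `x * y = 0` and `x = y` matter
(`detPoly_pos_of_endpoints`). With `F` the sum at vertex `A`, the estimate works for cosines up to
`1/2`; with `F` the sum at the centroid of equiangular lines, it works for cosines above `1/2`. The
form degenerates only at the centroid, where Cauchy–Schwarz must be an equality and so determines
`p`. -/

/-! ### Positivity of the quadratic form -/

/-- Sylvester's criterion needs only the full determinant `hdet` here: since `g ≥ 0`, a positive
determinant with a positive diagonal already forces the minor `n₁ n₃ - h²` to be positive. Then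
complete squares. -/
theorem quadForm_pos {n₁ n₂ n₃ g h v₁ v₂ v₃ : ℝ} (h₁ : 0 < n₁) (h₂ : 0 < n₂) (h₃ : 0 < n₃)
    (hg : 0 ≤ g) (hdet : 0 < n₃ * (n₁ * n₂ - g ^ 2) - h ^ 2 * (n₁ + n₂ + 2 * g))
    (hv : v₁ ≠ 0 ∨ v₂ ≠ 0 ∨ v₃ ≠ 0) :
    0 < n₁ * v₁ ^ 2 + n₂ * v₂ ^ 2 + n₃ * v₃ ^ 2 - 2 * g * v₁ * v₂ - 2 * h * v₃ * (v₁ + v₂) := by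
  have hP : 0 < n₁ * n₃ - h ^ 2 := by
    have : 0 < n₂ * (n₁ * n₃ - h ^ 2) := by
      have e : n₂ * (n₁ * n₃ - h ^ 2) = (n₃ * (n₁ * n₂ - g ^ 2) - h ^ 2 * (n₁ + n₂ + 2 * g))
        + (n₃ * g ^ 2 + h ^ 2 * n₁ + 2 * g * h ^ 2) := by ring
      rw [e]; positivity
    exact pos_of_mul_pos_right this h₂.le
  set T := g * n₃ + h ^ 2
  set P := n₁ * n₃ - h ^ 2
  set D := n₃ * (n₁ * n₂ - g ^ 2) - h ^ 2 * (n₁ + n₂ + 2 * g)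
  set q := n₁ * v₁ ^ 2 + n₂ * v₂ ^ 2 + n₃ * v₃ ^ 2 - 2 * g * v₁ * v₂ - 2 * h * v₃ * (v₁ + v₂)
  have e : n₃ * P * q = P * (n₃ * v₃ - h * (v₁ + v₂)) ^ 2 + (P * v₁ - T * v₂) ^ 2
      + n₃ * D * v₂ ^ 2 := by
    simp only [P, q, T, D]; ring
  have hq : 0 < n₃ * P * q := by
    rw [e]
    by_cases c₂ : v₂ = 0
    · by_cases c₁ : v₁ = 0
      · have c₃ : v₃ ≠ 0 := by tauto
        subst c₁ c₂
        have : 0 < P * (n₃ * v₃) ^ 2 := by positivity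
        simpa using this
      · subst c₂
        have : 0 < (P * v₁) ^ 2 := by positivity
        have : 0 ≤ P * (n₃ * v₃ - h * (v₁ + 0)) ^ 2 := by positivity
        simp only [mul_zero, sub_zero]
        nlinarith
    · have : 0 < n₃ * D * v₂ ^ 2 := by positivity
      have : 0 ≤ P * (n₃ * v₃ - h * (v₁ + v₂)) ^ 2 := by positivity
      nlinarith [sq_nonneg (P * v₁ - T * v₂)]
  exact pos_of_mul_pos_right hq (by positivity)

/-- The quadratic form obtained from distances `x`, `y`, `z`, with `F` in the role of their sum. -/
noncomputable def distForm (F g h x y z v₁ v₂ v₃ : ℝ) : ℝ :=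
  (x * (1 / x + 1 / y + 1 / z - F) - 1) * v₁ ^ 2 + (y * (1 / x + 1 / y + 1 / z - F) - 1) * v₂ ^ 2
    + (z * (1 / x + 1 / y + 1 / z - F) - 1) * v₃ ^ 2
    - 2 * g * v₁ * v₂ - 2 * h * v₃ * (v₁ + v₂)

/-- The determinant of `distForm`, times `x * y * z`, as a function of `m = x * y`. -/
noncomputable def detPoly (F g h z m : ℝ) : ℝ :=
  (z * (F - z) + m * (1 - F * z)) *
    ((F - z) * (1 - h ^ 2) + z * (1 - g ^ 2) - F * (z * (F - z) + m * (1 - F * z)))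
    - m * z * ((1 - g) * (1 + g - 2 * h ^ 2))

/-- By AM-GM, `F x y ≤ 2 x y ≤ (x + y)² / 2 < x + y`. This makes the diagonal coefficients of
`distForm` positive. -/
theorem harmonic_bound {F x y : ℝ} (hx : 0 < x) (hy : 0 < y) (hF : F ≤ 2) (hs : x + y < F) :
    0 < x + y - F * x * y := by
  nlinarith [sq_nonneg (x - y), mul_pos hx hy]

theorem eq_of_not_mul_lt_sq_midpoint {x y : ℝ} (h : ¬ x * y < ((x + y) / 2) ^ 2) : x = y := by
  have : (x - y) ^ 2 = 0 := by nlinarith [sq_nonneg (x - y)]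
  linarith [pow_eq_zero_iff two_ne_zero |>.1 this]

theorem distForm_pos {F g h x y z v₁ v₂ v₃ : ℝ} (hx : 0 < x) (hy : 0 < y) (hz : 0 < z)
    (hF : x + y + z = F) (hF2 : F ≤ 2) (hg : 0 ≤ g) (hdet : 0 < detPoly F g h z (x * y))
    (hv : v₁ ≠ 0 ∨ v₂ ≠ 0 ∨ v₃ ≠ 0) : 0 < distForm F g h x y z v₁ v₂ v₃ := by
  have key : ∀ x y z : ℝ, 0 < x → 0 < y → 0 < z → x + y + z = F →
      0 < x * (1 / x + 1 / y + 1 / z - F) - 1 := by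
    intro x y z hx hy hz hF
    have := harmonic_bound hy hz hF2 (by linarith)
    have e : x * (1 / x + 1 / y + 1 / z - F) - 1 = x * (y + z - F * y * z) / (y * z) := by
      field_simp; ring
    rw [e]; positivity
  refine quadForm_pos (key x y z hx hy hz hF) ?_ ?_ hg ?_ hv
  · have := key y x z hy hx hz (by linarith)
    rwa [add_comm (1 / y)] at this
  · have := key z x y hz hx hy (by linarith)
    rwa [show 1 / z + 1 / x + 1 / y = 1 / x + 1 / y + 1 / z by ring] at this
  · refine pos_of_mul_pos_right (a := x * y * z) ?_ (by positivity)
    refine hdet.trans_eq ?_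
    subst hF
    unfold detPoly
    field_simp
    ring

/-- `detPoly` is quadratic in `m` with leading coefficient `-F (1 - F z)²`, hence concave; the
identity `e` is the chord inequality with its exact remainder. -/
theorem detPoly_pos_of_endpoints {F g h z k m : ℝ} (hm : 0 < m) (hmk : m ≤ k ^ 2) (hF : 0 ≤ F)
    (h₀ : 0 ≤ detPoly F g h z 0) (h₁ : 0 ≤ detPoly F g h z (k ^ 2))
    (hs : 0 < detPoly F g h z (k ^ 2) ∨ m < k ^ 2 ∧ 0 < detPoly F g h z 0) :
    0 < detPoly F g h z m := by
  have hk : 0 < k ^ 2 := lt_of_lt_of_le hm hmk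
  have e : k ^ 2 * detPoly F g h z m = (k ^ 2 - m) * detPoly F g h z 0
      + m * detPoly F g h z (k ^ 2) + F * (1 - F * z) ^ 2 * m * k ^ 2 * (k ^ 2 - m) := by
    unfold detPoly; ring
  refine pos_of_mul_pos_right (a := k ^ 2) ?_ hk.le
  rw [e]
  have h₂ : 0 ≤ k ^ 2 - m := by linarith
  have h₃ : 0 ≤ F * (1 - F * z) ^ 2 * m * k ^ 2 * (k ^ 2 - m) := by positivity
  have h₄ : 0 ≤ (k ^ 2 - m) * detPoly F g h z 0 := by positivity
  have h₅ : 0 ≤ m * detPoly F g h z (k ^ 2) := by positivity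
  rcases hs with hs | ⟨hs, hs'⟩
  · have : 0 < m * detPoly F g h z (k ^ 2) := by positivity
    linarith
  · have : 0 < (k ^ 2 - m) * detPoly F g h z 0 := mul_pos (by linarith) hs'
    linarith

/-- For `x = y = k` the form is symmetric in `v₁`, `v₂`: the factors come from the antisymmetric
direction `(1, -1, 0)` and from the 2×2 block on its complement. -/
theorem detPoly_sq {F g h z k : ℝ} (hk : z = F - 2 * k) :
    detPoly F g h z (k ^ 2) = k * (z * (1 + g) + k - F * z * k) *
      (((1 - g) * z + k - F * z * k) * (2 - F * k) - 2 * h ^ 2 * k) := by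
  subst hk; unfold detPoly; ring

/-- Positivity of `distForm` when all angles are at least `60°`. -/
theorem distForm_pos_of_le_half {β γ g h x y z v₁ v₂ v₃ : ℝ} (hx : 0 < x) (hy : 0 < y)
    (hz : 0 < z) (hh : 0 ≤ h) (hhg : h ≤ g) (hg : g ≤ 1 / 2) (hβ : 0 < β) (hγ : 0 < γ)
    (hβ2 : β ^ 2 = 1 - h ^ 2) (hγ2 : γ ^ 2 = 1 - g ^ 2) (hs : x + y + z = β + γ)
    (hne : ¬ (g = 1 / 2 ∧ h = 1 / 2 ∧ x = y ∧ y = z)) (hv : v₁ ≠ 0 ∨ v₂ ≠ 0 ∨ v₃ ≠ 0) :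
    0 < distForm (β + γ) g h x y z v₁ v₂ v₃ := by
  have hγβ : γ ≤ β := by
    refine (sq_le_sq₀ hγ.le hβ.le).1 ?_
    nlinarith
  have hβ1 : β ≤ 1 := by nlinarith [sq_nonneg h]
  refine distForm_pos hx hy hz hs (by linarith) (hh.trans hhg) ?_ hv
  obtain ⟨k, hk⟩ : ∃ k, k = (x + y) / 2 := ⟨_, rfl⟩
  have hkpos : 0 < k := by rw [hk]; positivity
  have hzk : z = β + γ - 2 * k := by rw [hk]; linarith
  -- The double root `z = β` is the vertex `A`, whose distances are `(0, γ, β)`.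
  have h₀ : detPoly (β + γ) g h z 0 = (β + γ) * z * (β + γ - z) * (β - z) ^ 2 := by
    have e₁ : h ^ 2 = 1 - β ^ 2 := by linarith
    have e₂ : g ^ 2 = 1 - γ ^ 2 := by linarith
    unfold detPoly; rw [e₁, e₂]; ring
  have h₁ := detPoly_sq (g := g) (h := h) hzk
  set q := 2 * ((β + γ) * k) ^ 2 - (5 - 2 * g) * ((β + γ) * k) + 4 * (1 - g) with hq
  have hQ : ((1 - g) * z + k - (β + γ) * z * k) * (2 - (β + γ) * k) - 2 * h ^ 2 * k
      = z / 2 * q + (β - γ) * k * (3 * β + γ) / 2 := by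
    have e₁ : h ^ 2 = 1 - β ^ 2 := by linarith
    rw [e₁, hq, hzk]; ring
  -- The discriminant of `q` in `(β + γ) k` is `(2g - 1)(2g + 7)`, so `q ≥ 0` exactly because `g ≤
  -- 1/2`.
  have h8 : 8 * q = (4 * ((β + γ) * k) - (5 - 2 * g)) ^ 2 + (1 - 2 * g) * (7 + 2 * g) := by
    rw [hq]; ring
  have hg₁ : 0 ≤ (1 - 2 * g) * (7 + 2 * g) := mul_nonneg (by linarith) (by linarith)
  have hq₀ : 0 ≤ q := by linarith [sq_nonneg (4 * ((β + γ) * k) - (5 - 2 * g))]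
  have hfac : 0 < k * (z * (1 + g) + k - (β + γ) * z * k) := by
    have := harmonic_bound (F := β + γ) hz hkpos (by linarith) (by linarith)
    have : 0 ≤ z * g := mul_nonneg hz.le (hh.trans hhg)
    refine mul_pos hkpos (by linarith)
  have hd : 0 ≤ (β - γ) * k * (3 * β + γ) / 2 := by
    have : 0 ≤ β - γ := by linarith
    positivity
  have hQ₀ : 0 ≤ z / 2 * q := by positivity
  have hmk : x * y ≤ k ^ 2 := by rw [hk]; nlinarith [sq_nonneg (x - y)]
  refine detPoly_pos_of_endpoints (k := k) (by positivity) hmk (by linarith) ?_ ?_ ?_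
  · rw [h₀]
    have : 0 ≤ β + γ - z := by linarith
    positivity
  · rw [h₁, hQ]; exact mul_nonneg hfac.le (by linarith)
  -- Failure at `x = y = k` makes every nonnegative term vanish, forcing `g = h = 1/2` and `(β + γ)
  -- k = 1`. Failure at `m = 0` as well would give `z = β`, `k = β / 2`, hence `(β + γ) k = 3/4`; so
  -- `x = y = z`.
  · by_contra hcon
    push Not at hcon
    obtain ⟨c₁, c₂⟩ := hcon
    have hQz : z / 2 * q + (β - γ) * k * (3 * β + γ) / 2 ≤ 0 := by
      by_contra hc
      rw [h₁, hQ] at c₁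
      exact absurd (mul_pos hfac (not_le.1 hc)) (not_lt.2 c₁)
    have hβγ : β = γ := by
      by_contra hc
      have : 0 < (β - γ) * k * (3 * β + γ) / 2 := by
        have : 0 < β - γ := lt_of_le_of_ne (by linarith) (fun e => hc (by linarith))
        positivity
      linarith
    have hq0 : q = 0 := by
      by_contra hc
      have : 0 < z / 2 * q := by
        have : 0 < q := lt_of_le_of_ne hq₀ (Ne.symm hc)
        positivity
      linarith
    have hg2 : g = 1 / 2 := by
      by_contra hc
      have : g < 1 / 2 := lt_of_le_of_ne hg hc
      have : 0 < (1 - 2 * g) * (7 + 2 * g) := mul_pos (by linarith) (by linarith)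
      linarith [sq_nonneg (4 * ((β + γ) * k) - (5 - 2 * g))]
    have hh2 : h = 1 / 2 := by
      subst hβγ hg2
      exact (sq_eq_sq₀ hh (by norm_num)).1 (by linarith)
    have hκ : (β + γ) * k = 1 := by
      have : ((β + γ) * k - 1) ^ 2 = 0 := by
        rw [hq0, hg2] at h8
        linarith
      linarith [pow_eq_zero_iff two_ne_zero |>.1 this]
    subst hβγ
    rw [hh2] at hβ2
    by_cases hm : x * y < k ^ 2
    · have := c₂ hm
      rw [h₀] at this
      have hzβ : z = β := by
        by_contra hc
        have : β - z ≠ 0 := fun e => hc (by linarith)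
        have : 0 < β + β - z := by linarith
        have : 0 < (β + β) * z * (β + β - z) * (β - z) ^ 2 := by positivity
        linarith
      have hk2 : k = β / 2 := by linarith
      rw [hk2] at hκ
      linarith
    · have hxy : x = y := eq_of_not_mul_lt_sq_midpoint (hk ▸ hm)
      refine hne ⟨hg2, hh2, hxy, ?_⟩
      have hky : k = y := by rw [hk, hxy]; ring
      rw [← hky]
      have : (β + β) * (k - z) = 0 := by rw [hzk]; linarith
      rcases mul_eq_zero.1 this with e | e <;> linarith

/-- Positivity of `distForm` for equiangular lines with angle less than `60°`. -/
theorem distForm_pos_of_half_lt {F g x y z v₁ v₂ v₃ : ℝ} (hx : 0 < x) (hy : 0 < y)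
    (hz : 0 < z) (hg : 1 / 2 < g) (hg1 : g < 1) (hF : 0 < F) (hF2 : F ^ 2 = 6 * (1 - g))
    (hs : x + y + z = F) (hne : ¬ (x = y ∧ y = z)) (hv : v₁ ≠ 0 ∨ v₂ ≠ 0 ∨ v₃ ≠ 0) :
    0 < distForm F g g x y z v₁ v₂ v₃ := by
  have hF' : F ≤ 2 := by nlinarith
  refine distForm_pos hx hy hz hs hF' (by linarith) ?_ hv
  obtain ⟨k, hk⟩ : ∃ k, k = (x + y) / 2 := ⟨_, rfl⟩
  have hkpos : 0 < k := by rw [hk]; positivity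
  have hzk : z = F - 2 * k := by rw [hk]; linarith
  have h₀ : 0 < detPoly F g g z 0 := by
    have e : detPoly F g g z 0 = F * z * (F - z) * (1 - g ^ 2 - z * (F - z)) := by
      unfold detPoly; ring
    rw [e]
    have h₁ : 0 < F - z := by linarith
    -- `z (F - z) ≤ F² / 4 = 3 (1 - g) / 2 < (1 - g)(1 + g)`, as `g > 1/2`.
    have h₂ : 0 < 1 - g ^ 2 - z * (F - z) := by nlinarith [sq_nonneg (F - 2 * z)]
    positivity
  have h₁ := detPoly_sq (g := g) (h := g) hzk
  have hfac : 0 < k * (z * (1 + g) + k - F * z * k) := by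
    have := harmonic_bound (F := F) hz hkpos hF' (by linarith)
    have : 0 < z * g := mul_pos hz (by linarith)
    refine mul_pos hkpos (by linarith)
  -- The double root `F k = 2 (1 - g) = F² / 3` is `k = F / 3`, the centroid.
  have hQ : F * (((1 - g) * z + k - F * z * k) * (2 - F * k) - 2 * g ^ 2 * k)
      = (F * k - 2 * (1 - g)) ^ 2 * (3 - 2 * (F * k)) := by
    have e : g = 1 - F ^ 2 / 6 := by linarith
    rw [e, hzk]; ring
  have hκ : 0 < 3 - 2 * (F * k) := by
    have : F * (2 * k) < F * F := mul_lt_mul_of_pos_left (by linarith) hF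
    linarith
  have hQ₀ : 0 ≤ ((1 - g) * z + k - F * z * k) * (2 - F * k) - 2 * g ^ 2 * k := by
    refine nonneg_of_mul_nonneg_right (a := F) ?_ hF
    rw [hQ]; positivity
  have hmk : x * y ≤ k ^ 2 := by rw [hk]; nlinarith [sq_nonneg (x - y)]
  refine detPoly_pos_of_endpoints (k := k) (by positivity) hmk hF.le h₀.le ?_ ?_
  · rw [h₁]; positivity
  · by_contra hcon
    push Not at hcon
    obtain ⟨c₁, c₂⟩ := hcon
    have hm : ¬ x * y < k ^ 2 := fun hm => absurd h₀ (not_lt.2 (c₂ hm))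
    have hxy : x = y := eq_of_not_mul_lt_sq_midpoint (hk ▸ hm)
    refine hne ⟨hxy, ?_⟩
    have hky : k = y := by rw [hk, hxy]; ring
    have hκ0 : F * k - 2 * (1 - g) = 0 := by
      by_contra hc
      have : 0 < F * (((1 - g) * z + k - F * z * k) * (2 - F * k) - 2 * g ^ 2 * k) := by
        rw [hQ]; positivity
      have := pos_of_mul_pos_right this hF.le
      rw [h₁] at c₁
      exact absurd (mul_pos hfac this) (not_lt.2 c₁)
    rw [← hky]
    have : F * (k - z) = 0 := by rw [hzk]; linarith
    rcases mul_eq_zero.1 this with e | e <;> linarith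

/-- At the centroid the diagonal coefficients equal `2 g`, and the form is a sum of squared
differences: degenerate along `(1, 1, 1)`, yet still semidefinite. -/
theorem distForm_nonneg_of_eq {F g x v₁ v₂ v₃ : ℝ} (hx : 0 < x) (hg : 0 ≤ g) (hF : 3 * x = F)
    (hF2 : F ^ 2 = 6 * (1 - g)) : 0 ≤ distForm F g g x x x v₁ v₂ v₃ := by
  have e : x * (1 / x + 1 / x + 1 / x - F) - 1 = 2 * g := by
    have : x ^ 2 = 2 * (1 - g) / 3 := by subst hF; linarith
    field_simp
    subst hF; linarith
  have e' : distForm F g g x x x v₁ v₂ v₃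
      = g * ((v₁ - v₂) ^ 2 + (v₁ - v₃) ^ 2 + (v₂ - v₃) ^ 2) := by
    unfold distForm; rw [e]; ring
  rw [e']; positivity

/-! ### From Cauchy–Schwarz to the quadratic form -/

section InnerProduct

variable {V : Type*} [NormedAddCommGroup V] [InnerProductSpace ℝ V]

theorem norm_sq_smul_add_smul_add_smul {a b c : V} (ha : ‖a‖ = 1) (hb : ‖b‖ = 1) (hc : ‖c‖ = 1)
    (u₁ u₂ u₃ : ℝ) : ‖u₁ • a + u₂ • b + u₃ • c‖ ^ 2 = u₁ ^ 2 + u₂ ^ 2 + u₃ ^ 2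
      + 2 * (u₁ * u₂ * inner ℝ a b) + 2 * (u₁ * u₃ * inner ℝ a c)
      + 2 * (u₂ * u₃ * inner ℝ b c) := by
  rw [← real_inner_self_eq_norm_sq]
  simp only [inner_add_left, inner_add_right, real_inner_smul_left, real_inner_smul_right,
    real_inner_self_eq_norm_sq, real_inner_comm a b, real_inner_comm a c, real_inner_comm b c,
    norm_smul, mul_pow, Real.norm_eq_abs, sq_abs, ha, hb, hc]
  ring

theorem distForm_le_of_unit {a b c p : V} {g h x y z : ℝ} (ha : ‖a‖ = 1) (hb : ‖b‖ = 1)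
    (hc : ‖c‖ = 1) (hp : ‖p‖ = 1) (hab : |inner ℝ a b| ≤ g) (hac : |inner ℝ a c| ≤ h)
    (hx : 0 < x) (hy : 0 < y) (hz : 0 < z)
    (hx2 : x ^ 2 = 1 - (inner ℝ a p) ^ 2) (hy2 : y ^ 2 = 1 - (inner ℝ b p) ^ 2)
    (hz2 : z ^ 2 = 1 - (inner ℝ c p) ^ 2) :
    distForm (x + y + z) g h x y z (|inner ℝ a p| / x) (|inner ℝ b p| / y) (|inner ℝ c p| / z) ≤
      -2 * (h - |inner ℝ b c|) * (|inner ℝ b p| / y) * (|inner ℝ c p| / z) := by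
  set s₁ : ℝ := inner ℝ a p
  set s₂ : ℝ := inner ℝ b p
  set s₃ : ℝ := inner ℝ c p
  set u₁ := s₁ / x with hu₁
  set u₂ := s₂ / y with hu₂
  set u₃ := s₃ / z with hu₃
  have e₁ : |s₁| / x = |u₁| := by rw [hu₁, abs_div, abs_of_pos hx]
  have e₂ : |s₂| / y = |u₂| := by rw [hu₂, abs_div, abs_of_pos hy]
  have e₃ : |s₃| / z = |u₃| := by rw [hu₃, abs_div, abs_of_pos hz]
  rw [e₁, e₂, e₃]
  set K := 1 / x + 1 / y + 1 / z - (x + y + z) with hK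
  have hKu : K = x * u₁ ^ 2 + y * u₂ ^ 2 + z * u₃ ^ 2 := by
    have f₁ : x * u₁ ^ 2 = 1 / x - x := by
      rw [hu₁, div_pow, show s₁ ^ 2 = 1 - x ^ 2 by linarith]; field_simp
    have f₂ : y * u₂ ^ 2 = 1 / y - y := by
      rw [hu₂, div_pow, show s₂ ^ 2 = 1 - y ^ 2 by linarith]; field_simp
    have f₃ : z * u₃ ^ 2 = 1 / z - z := by
      rw [hu₃, div_pow, show s₃ ^ 2 = 1 - z ^ 2 by linarith]; field_simp
    rw [f₁, f₂, f₃, hK]; ring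
  have hKq : inner ℝ (u₁ • a + u₂ • b + u₃ • c) p = K := by
    rw [inner_add_left, inner_add_left, real_inner_smul_left, real_inner_smul_left,
      real_inner_smul_left, hKu]
    change u₁ * s₁ + u₂ * s₂ + u₃ * s₃ = _
    rw [hu₁, hu₂, hu₃]
    field_simp
  have hq := norm_sq_smul_add_smul_add_smul ha hb hc u₁ u₂ u₃
  have hCS : K ^ 2 ≤ ‖u₁ • a + u₂ • b + u₃ • c‖ ^ 2 := by
    have := abs_real_inner_le_norm (u₁ • a + u₂ • b + u₃ • c) p
    rw [hKq, hp, mul_one] at this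
    rw [← sq_abs K]
    exact pow_le_pow_left₀ (abs_nonneg _) this 2
  have bd : ∀ u v r t : ℝ, |r| ≤ t → u * v * r ≤ |u| * |v| * t := by
    intro u v r t hr
    calc u * v * r ≤ |u * v * r| := le_abs_self _
      _ = |u| * |v| * |r| := by rw [abs_mul, abs_mul]
      _ ≤ _ := by gcongr
  have b₁ := bd u₁ u₂ _ _ hab
  have b₂ := bd u₁ u₃ _ _ hac
  have b₃ := bd u₂ u₃ _ _ (le_refl |inner ℝ b c|)
  unfold distForm
  rw [← hK]
  have e : (x * K - 1) * |u₁| ^ 2 + (y * K - 1) * |u₂| ^ 2 + (z * K - 1) * |u₃| ^ 2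
      = K ^ 2 - (u₁ ^ 2 + u₂ ^ 2 + u₃ ^ 2) := by
    rw [sq_abs, sq_abs, sq_abs]
    calc _ = K * (x * u₁ ^ 2 + y * u₂ ^ 2 + z * u₃ ^ 2) - (u₁ ^ 2 + u₂ ^ 2 + u₃ ^ 2) := by ring
      _ = _ := by rw [← hKu]; ring
  rw [e]
  linarith

/-- With `e` the actual sum and `s = F / e ≥ 1`, the correction has a sign, so sums below `F` reduce
to sum `F`. -/
theorem distForm_smul {F e g h x y z s v₁ v₂ v₃ : ℝ} (hs : 0 < s) :
    distForm F g h (s * x) (s * y) (s * z) v₁ v₂ v₃ = distForm e g h x y z v₁ v₂ v₃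
      - (s * F - e) * (x * v₁ ^ 2 + y * v₂ ^ 2 + z * v₃ ^ 2) := by
  have e' : ∀ t, s * t * (1 / (s * x) + 1 / (s * y) + 1 / (s * z) - F)
      = t * (1 / x + 1 / y + 1 / z - e) - t * (s * F - e) := by
    intro t
    have : s * (1 / (s * x) + 1 / (s * y) + 1 / (s * z)) = 1 / x + 1 / y + 1 / z := by
      rw [mul_add, mul_add]
      simp only [one_div, mul_inv, mul_inv_cancel_left₀ hs.ne']
    calc _ = t * (s * (1 / (s * x) + 1 / (s * y) + 1 / (s * z))) - t * (s * F) := by ring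
      _ = _ := by rw [this]; ring
  unfold distForm
  rw [e', e', e']
  ring

/-- If `distForm` is positive except possibly at equal distances, then the sum of the distances
is less than or equal to `F` only in the case of equality. -/
theorem eq_of_add_dist_le {a b c p : V} {F g h x y z : ℝ} {C : Prop} (ha : ‖a‖ = 1)
    (hb : ‖b‖ = 1) (hc : ‖c‖ = 1) (hp : ‖p‖ = 1) (hab : |inner ℝ a b| ≤ g)
    (hac : |inner ℝ a c| ≤ h) (hbc : |inner ℝ b c| ≤ h)
    (hx : 0 < x) (hy : 0 < y) (hz : 0 < z)
    (hx2 : x ^ 2 = 1 - (inner ℝ a p) ^ 2) (hy2 : y ^ 2 = 1 - (inner ℝ b p) ^ 2)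
    (hz2 : z ^ 2 = 1 - (inner ℝ c p) ^ 2) (hF2 : F ≤ 2) (hF : x + y + z ≤ F)
    (hpos : ∀ x y z v₁ v₂ v₃ : ℝ, 0 < x → 0 < y → 0 < z → x + y + z = F →
      ¬ (C ∧ x = y ∧ y = z) → (v₁ ≠ 0 ∨ v₂ ≠ 0 ∨ v₃ ≠ 0) → 0 < distForm F g h x y z v₁ v₂ v₃)
    (hC : C → h = g ∧ F ^ 2 = 6 * (1 - g)) :
    C ∧ x = y ∧ y = z ∧ x + y + z = F ∧ |inner ℝ b c| = h := by
  have hle := distForm_le_of_unit ha hb hc hp hab hac hx hy hz hx2 hy2 hz2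
  have hne : ∀ {t u : ℝ}, 0 < t → t < 1 → t ^ 2 = 1 - u ^ 2 → 0 < |u| / t := by
    intro t u ht ht1 h
    refine div_pos (abs_pos.2 ?_) ht
    rintro rfl
    nlinarith
  have hv : |inner ℝ a p| / x ≠ 0 ∨ |inner ℝ b p| / y ≠ 0 ∨ |inner ℝ c p| / z ≠ 0 := by
    by_cases h1 : x < 1
    · exact Or.inl (hne hx h1 hx2).ne'
    · by_cases h2 : y < 1
      · exact Or.inr (Or.inl (hne hy h2 hy2).ne')
      · linarith
  set v₁ := |inner ℝ a p| / x
  set v₂ := |inner ℝ b p| / y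
  set v₃ := |inner ℝ c p| / z
  set e := x + y + z with he
  have he0 : 0 < e := by positivity
  obtain ⟨s, hs⟩ : ∃ s, s = F / e := ⟨_, rfl⟩
  have hse : s * e = F := by rw [hs]; field_simp
  have hs1 : 1 ≤ s := by rw [hs, one_le_div he0]; exact hF
  have hs0 : 0 < s := by linarith
  have hsF : e ≤ s * F := by nlinarith
  have hv₂ : 0 ≤ v₂ := by positivity
  have hv₃ : 0 ≤ v₃ := by positivity
  have hneg : 0 ≤ 2 * (h - |inner ℝ b c|) * v₂ * v₃ := by
    have : 0 ≤ h - |inner ℝ b c| := by linarith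
    positivity
  have hscale : 0 ≤ (s * F - e) * (x * v₁ ^ 2 + y * v₂ ^ 2 + z * v₃ ^ 2) := by
    have : 0 ≤ s * F - e := by linarith
    positivity
  have hform := distForm_smul (F := F) (e := e) (g := g) (h := h) (x := x) (y := y) (z := z)
    (v₁ := v₁) (v₂ := v₂) (v₃ := v₃) hs0
  have hexc : C ∧ s * x = s * y ∧ s * y = s * z := by
    by_contra hcon
    have := hpos (s * x) (s * y) (s * z) v₁ v₂ v₃ (by positivity) (by positivity) (by positivity)
      (by rw [← hse, he]; ring) hcon hv
    linarith
  obtain ⟨hc', hxy, hyz⟩ := hexc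
  obtain ⟨hhg, hFg⟩ := hC hc'
  have hg : 0 ≤ g := (abs_nonneg _).trans hab
  -- The form is now both nonnegative and at most minus the slacks `hscale` and `hneg`, so both
  -- slacks vanish.
  have hnn : 0 ≤ distForm F g h (s * x) (s * y) (s * z) v₁ v₂ v₃ := by
    rw [← hyz, ← hxy, hhg]
    refine distForm_nonneg_of_eq (by positivity) hg ?_ hFg
    rw [← hse, he]; linarith
  have hxy' : x = y := mul_left_cancel₀ hs0.ne' hxy
  have hyz' : y = z := mul_left_cancel₀ hs0.ne' hyz
  have hx1 : x < 1 := by linarith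
  have p₁ : 0 < v₁ := hne hx hx1 hx2
  have p₂ : 0 < v₂ := hne hy (by linarith) hy2
  have p₃ : 0 < v₃ := hne hz (by linarith) hz2
  refine ⟨hc', hxy', hyz', ?_, ?_⟩
  · by_contra hcon
    have : e < F := lt_of_le_of_ne hF hcon
    have : 0 < s * F - e := by nlinarith
    have : 0 < (s * F - e) * (x * v₁ ^ 2 + y * v₂ ^ 2 + z * v₃ ^ 2) := by positivity
    linarith
  · by_contra hcon
    have : 0 < h - |inner ℝ b c| := by linarith [lt_of_le_of_ne hbc hcon]
    have : 0 < 2 * (h - |inner ℝ b c|) * v₂ * v₃ := by positivity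
    linarith

theorem norm_sq_add_add_of_equiangular {a b c : V} {g : ℝ} (ha : ‖a‖ = 1) (hb : ‖b‖ = 1)
    (hc : ‖c‖ = 1) (hab : inner ℝ a b = g) (hac : inner ℝ a c = g) (hbc : inner ℝ b c = g) :
    ‖a + b + c‖ ^ 2 = 3 + 6 * g := by
  have h := norm_sq_smul_add_smul_add_smul ha hb hc 1 1 1
  simp only [one_smul, hab, hac, hbc] at h
  linarith

/-- A unit vector making the same angle as the centroid with three equiangular lines spans the
centroid. -/
theorem exists_smul_centroid_eq {a b c p : V} {g : ℝ} (ha : ‖a‖ = 1) (hb : ‖b‖ = 1)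
    (hc : ‖c‖ = 1) (hp : ‖p‖ = 1) (hab : inner ℝ a b = g) (hac : inner ℝ a c = g)
    (hbc : inner ℝ b c = g) (hg : 0 < g) (h₁ : (inner ℝ a p) ^ 2 = (1 + 2 * g) / 3)
    (h₂ : (inner ℝ b p) ^ 2 = (1 + 2 * g) / 3) (h₃ : (inner ℝ c p) ^ 2 = (1 + 2 * g) / 3) :
    ∃ r : ℝ, r • (a + b + c) = p := by
  -- The signs of the three inner products with `p` must agree: a mixed pattern would give `3 + 6 g
  -- ≤ 3 - 2 g`. Agreement gives equality in Cauchy–Schwarz for `a + b + c` and `p`.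
  have CS : ∀ e₂ e₃ : ℝ, e₂ ^ 2 = 1 → e₃ ^ 2 = 1 →
      (inner ℝ a p + e₂ * inner ℝ b p + e₃ * inner ℝ c p) ^ 2
        ≤ 3 + 2 * g * (e₂ + e₃ + e₂ * e₃) := by
    intro e₂ e₃ i₂ i₃
    have h := abs_real_inner_le_norm ((1 : ℝ) • a + e₂ • b + e₃ • c) p
    rw [hp, mul_one] at h
    have h' := pow_le_pow_left₀ (abs_nonneg _) h 2
    rw [sq_abs, norm_sq_smul_add_smul_add_smul ha hb hc, i₂, i₃, hab, hac, hbc] at h'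
    simp only [inner_add_left, real_inner_smul_left] at h'
    linarith
  have hnorm := norm_sq_add_add_of_equiangular ha hb hc hab hac hbc
  have hsum : (inner ℝ (a + b + c) p) ^ 2 = 3 + 6 * g := by
    rw [inner_add_left, inner_add_left]
    rcases sq_eq_sq_iff_eq_or_eq_neg.1 (h₂.trans h₁.symm) with i₂ | i₂ <;>
      rcases sq_eq_sq_iff_eq_or_eq_neg.1 (h₃.trans h₁.symm) with i₃ | i₃ <;> rw [i₂, i₃]
    · linarith
    · have := CS 1 (-1) (by norm_num) (by norm_num)
      rw [i₂, i₃] at this; linarith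
    · have := CS (-1) 1 (by norm_num) (by norm_num)
      rw [i₂, i₃] at this; linarith
    · have := CS (-1) (-1) (by norm_num) (by norm_num)
      rw [i₂, i₃] at this; linarith
  refine ⟨inner ℝ (a + b + c) p / (3 + 6 * g), ?_⟩
  rw [← sub_eq_zero, ← norm_eq_zero, ← pow_eq_zero_iff two_ne_zero, norm_sub_sq_real, norm_smul,
    mul_pow, hnorm, hp, real_inner_smul_left, Real.norm_eq_abs, sq_abs, div_pow, hsum]
  have : (3 + 6 * g) ≠ 0 := by positivity
  have e : inner ℝ (a + b + c) p / (3 + 6 * g) * inner ℝ (a + b + c) p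
      = (inner ℝ (a + b + c) p) ^ 2 / (3 + 6 * g) := by ring
  rw [e, hsum]
  field_simp
  ring

end InnerProduct

/-! ### Sine distance and angle in terms of unit vectors -/

section Line

theorem sineDist_mk (v w : EuclideanSpace ℝ (Fin 3)) (hv : v ≠ 0) (hw : w ≠ 0) :
    sineDist (Projectivization.mk ℝ v hv) (Projectivization.mk ℝ w hw) =
      √(1 - (inner ℝ v w / (‖v‖ * ‖w‖)) ^ 2) := by
  have h : sineDist (Projectivization.mk ℝ v hv) (Projectivization.mk ℝ w hw) =
      Real.sin (InnerProductGeometry.angle v w) := by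
    unfold sineDist
    rw [lineAngle_mk, InnerProductGeometry.angle_neg_right]
    rcases min_choice (InnerProductGeometry.angle v w)
      (Real.pi - InnerProductGeometry.angle v w) with h | h <;> rw [h]
    rw [Real.sin_pi_sub]
  rw [h, InnerProductGeometry.angle, Real.sin_arccos]

theorem cos_lineAngle_mk (v w : EuclideanSpace ℝ (Fin 3)) (hv : v ≠ 0) (hw : w ≠ 0) :
    Real.cos (lineAngle (Projectivization.mk ℝ v hv) (Projectivization.mk ℝ w hw)) =
      |inner ℝ v w / (‖v‖ * ‖w‖)| := by
  rw [lineAngle_mk, InnerProductGeometry.angle_neg_right, ← InnerProductGeometry.cos_angle]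
  have h₀ := InnerProductGeometry.angle_nonneg v w
  have h₁ := InnerProductGeometry.angle_le_pi v w
  rcases le_total (InnerProductGeometry.angle v w)
    (Real.pi - InnerProductGeometry.angle v w) with h | h
  · rw [min_eq_left h, abs_of_nonneg (Real.cos_nonneg_of_neg_pi_div_two_le_of_le
      (by linarith) (by linarith))]
  · rw [min_eq_right h, Real.cos_pi_sub, abs_of_nonpos (Real.cos_nonpos_of_pi_div_two_le_of_le
      (by linarith) (by linarith))]

theorem lineAngle_nonneg (P Q : ProjPlane) : 0 ≤ lineAngle P Q :=
  le_min (InnerProductGeometry.angle_nonneg _ _) (InnerProductGeometry.angle_nonneg _ _)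

theorem lineAngle_le (P Q : ProjPlane) : lineAngle P Q ≤ Real.pi / 2 := by
  unfold lineAngle
  rw [InnerProductGeometry.angle_neg_right, min_le_iff]
  by_contra! h
  linarith [h.1, h.2]

theorem sineDist_comm (P Q : ProjPlane) : sineDist P Q = sineDist Q P := by
  unfold sineDist lineAngle
  rw [InnerProductGeometry.angle_neg_right, InnerProductGeometry.angle_neg_right,
    InnerProductGeometry.angle_comm]

theorem sineDist_nonneg (P Q : ProjPlane) : 0 ≤ sineDist P Q :=
  Real.sin_nonneg_of_nonneg_of_le_pi (lineAngle_nonneg P Q)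
    (by linarith [lineAngle_le P Q, Real.pi_pos])

theorem sineDist_lt_of_lineAngle_lt {P Q R S : ProjPlane} (h : lineAngle P Q < lineAngle R S) :
    sineDist P Q < sineDist R S :=
  Real.sin_lt_sin_of_lt_of_le_pi_div_two
    (by linarith [lineAngle_nonneg P Q, Real.pi_pos]) (lineAngle_le R S) h

theorem exists_unit_eq_mk (P : ProjPlane) :
    ∃ (a : EuclideanSpace ℝ (Fin 3)) (ha : a ≠ 0), ‖a‖ = 1 ∧ P = Projectivization.mk ℝ a ha := by
  have h := P.rep_nonzero
  have hn : ‖P.rep‖⁻¹ ≠ 0 := inv_ne_zero (norm_ne_zero_iff.2 h)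
  refine ⟨‖P.rep‖⁻¹ • P.rep, smul_ne_zero hn h, ?_, ?_⟩
  · rw [norm_smul, norm_inv, norm_norm, inv_mul_cancel₀ (norm_ne_zero_iff.2 h)]
  · conv_lhs => rw [← P.mk_rep]
    rw [Projectivization.mk_eq_mk_iff']
    exact ⟨‖P.rep‖, by rw [smul_inv_smul₀ (norm_ne_zero_iff.2 h)]⟩

theorem sineDist_self (P : ProjPlane) : sineDist P P = 0 := by
  obtain ⟨a, ha, h1, rfl⟩ := exists_unit_eq_mk P
  rw [sineDist_mk, real_inner_self_eq_norm_sq, h1]; norm_num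

theorem sineDist_sq_of_unit {a b : EuclideanSpace ℝ (Fin 3)} (ha : a ≠ 0) (hb : b ≠ 0)
    (h₁ : ‖a‖ = 1) (h₂ : ‖b‖ = 1) :
    sineDist (Projectivization.mk ℝ a ha) (Projectivization.mk ℝ b hb) ^ 2
      = 1 - (inner ℝ a b) ^ 2 := by
  have : (inner ℝ a b) ^ 2 ≤ 1 := by
    have := abs_real_inner_le_norm a b
    rw [h₁, h₂, mul_one] at this
    exact (sq_le_one_iff_abs_le_one _).2 this
  rw [sineDist_mk, Real.sq_sqrt] <;> rw [h₁, h₂, mul_one, div_one]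
  linarith

theorem cos_lineAngle_of_unit {a b : EuclideanSpace ℝ (Fin 3)} (ha : a ≠ 0) (hb : b ≠ 0)
    (h₁ : ‖a‖ = 1) (h₂ : ‖b‖ = 1) :
    Real.cos (lineAngle (Projectivization.mk ℝ a ha) (Projectivization.mk ℝ b hb))
      = |inner ℝ a b| := by
  rw [cos_lineAngle_mk, h₁, h₂, mul_one, div_one]

theorem eq_of_sineDist_eq_zero {P Q : ProjPlane} (h : sineDist P Q = 0) : P = Q := by
  obtain ⟨a, ha, h₁, rfl⟩ := exists_unit_eq_mk P
  obtain ⟨b, hb, h₂, rfl⟩ := exists_unit_eq_mk Q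
  have hs := sineDist_sq_of_unit ha hb h₁ h₂
  rw [h] at hs
  have : |inner ℝ a b / (‖a‖ * ‖b‖)| = 1 := by
    rw [h₁, h₂, mul_one, div_one, ← sq_eq_sq₀ (abs_nonneg _) zero_le_one, sq_abs]
    linarith
  obtain ⟨-, r, hr, rfl⟩ := (abs_real_inner_div_norm_mul_norm_eq_one_iff a b).1 this
  rw [eq_comm, Projectivization.mk_eq_mk_iff']
  exact ⟨r, rfl⟩

theorem sineDist_pos {P Q : ProjPlane} (h : P ≠ Q) : 0 < sineDist P Q :=
  lt_of_le_of_ne (sineDist_nonneg P Q) fun e => h (eq_of_sineDist_eq_zero e.symm)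

end Line

/-! ### Minimizers of the sum of distances -/

section FermatTorricelli

/-- Showing that sums at most `F` occur only in `S` yields minimality and uniqueness together, with
no compactness argument for existence. -/
theorem fermatTorricelli_eq {A B C : ProjPlane} {S : Set ProjPlane} {F : ℝ} (hne : S.Nonempty)
    (hS : ∀ P ∈ S, sumDist A B C P = F) (hle : ∀ P, sumDist A B C P ≤ F → P ∈ S) :
    fermatTorricelli A B C = S := by
  ext P
  simp only [fermatTorricelli, Set.mem_ofPred_eq, isMinOn_univ_iff]
  constructor
  · intro hP
    obtain ⟨Q, hQ⟩ := hne
    exact hle P ((hP Q).trans (hS Q hQ).le)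
  · intro hP Q
    rw [hS P hP]
    by_contra! h
    exact h.ne (hS Q (hle Q h.le))

theorem sumDist_first (A B C : ProjPlane) : sumDist A B C A = sineDist A B + sineDist A C := by
  rw [sumDist, sineDist_self, sineDist_comm B A, sineDist_comm C A]; ring

theorem sumDist_second (A B C : ProjPlane) : sumDist A B C B = sineDist A B + sineDist B C := by
  rw [sumDist, sineDist_self, sineDist_comm C B]; ring

theorem sumDist_third (A B C : ProjPlane) : sumDist A B C C = sineDist A C + sineDist B C := by
  rw [sumDist, sineDist_self]; ring

/-- When all angles are at least `60°`, a point which is at least as good as the vertex `A` is a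
vertex, or the angles are all `60°` and the point is equidistant from the vertices. -/
theorem eq_vertex_or_of_sumDist_le {A B C P : ProjPlane}
    (h₁ : lineAngle A B ≤ lineAngle A C) (h₂ : lineAngle A C ≤ lineAngle B C)
    (h₀ : Real.pi / 3 ≤ lineAngle A B) (hP : sumDist A B C P ≤ sineDist A B + sineDist A C) :
    P = A ∨ P = B ∨ P = C ∨ (Real.cos (lineAngle A B) = 1 / 2 ∧ Real.cos (lineAngle A C) = 1 / 2 ∧
      Real.cos (lineAngle B C) = 1 / 2 ∧ sineDist A P = sineDist B P ∧
      sineDist B P = sineDist C P ∧ sumDist A B C P = sineDist A B + sineDist A C) := by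
  by_cases hA : P = A
  · exact Or.inl hA
  by_cases hB : P = B
  · exact Or.inr (Or.inl hB)
  by_cases hC : P = C
  · exact Or.inr (Or.inr (Or.inl hC))
  refine Or.inr (Or.inr (Or.inr ?_))
  have hpi := Real.pi_pos
  have hgh := Real.cos_le_cos_of_nonneg_of_le_pi (lineAngle_nonneg A B)
    (by linarith [lineAngle_le A C]) h₁
  have hh' := Real.cos_le_cos_of_nonneg_of_le_pi (lineAngle_nonneg A C)
    (by linarith [lineAngle_le B C]) h₂
  have hg := Real.cos_le_cos_of_nonneg_of_le_pi (by positivity)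
    (by linarith [lineAngle_le A B]) h₀
  rw [Real.cos_pi_div_three] at hg
  have hβ : 0 < sineDist A C := Real.sin_pos_of_pos_of_lt_pi (by linarith)
    (by linarith [lineAngle_le A C])
  have hγ : 0 < sineDist A B := Real.sin_pos_of_pos_of_lt_pi (by linarith)
    (by linarith [lineAngle_le A B])
  have hβ2 : sineDist A C ^ 2 = 1 - Real.cos (lineAngle A C) ^ 2 := Real.sin_sq _
  have hγ2 : sineDist A B ^ 2 = 1 - Real.cos (lineAngle A B) ^ 2 := Real.sin_sq _
  have hβ1 : sineDist A C ≤ 1 := Real.sin_le_one _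
  have hγ1 : sineDist A B ≤ 1 := Real.sin_le_one _
  have hx := sineDist_pos (Ne.symm hA)
  have hy := sineDist_pos (Ne.symm hB)
  have hz := sineDist_pos (Ne.symm hC)
  have hh0 : 0 ≤ Real.cos (lineAngle A C) := Real.cos_nonneg_of_neg_pi_div_two_le_of_le
    (by linarith [lineAngle_nonneg A C]) (lineAngle_le A C)
  obtain ⟨a, ha, ha1, rfl⟩ := exists_unit_eq_mk A
  obtain ⟨b, hb, hb1, rfl⟩ := exists_unit_eq_mk B
  obtain ⟨c, hc, hc1, rfl⟩ := exists_unit_eq_mk C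
  obtain ⟨p, hp, hp1, rfl⟩ := exists_unit_eq_mk P
  have key := eq_of_add_dist_le (C := Real.cos (lineAngle (.mk ℝ a ha) (.mk ℝ b hb)) = 1 / 2 ∧
      Real.cos (lineAngle (.mk ℝ a ha) (.mk ℝ c hc)) = 1 / 2) ha1 hb1 hc1 hp1
    (cos_lineAngle_of_unit ha hb ha1 hb1).ge (cos_lineAngle_of_unit ha hc ha1 hc1).ge
    ((cos_lineAngle_of_unit hb hc hb1 hc1).ge.trans hh') hx hy hz
    (sineDist_sq_of_unit ha hp ha1 hp1) (sineDist_sq_of_unit hb hp hb1 hp1)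
    (sineDist_sq_of_unit hc hp hc1 hp1) (by linarith)
    (hP.trans_eq (add_comm _ _)) ?_ ?_
  · obtain ⟨⟨c₁, c₂⟩, e₁, e₂, e₃, e₄⟩ := key
    refine ⟨c₁, c₂, ?_, e₁, e₂, e₃.trans (add_comm _ _)⟩
    rw [cos_lineAngle_of_unit hb hc hb1 hc1, e₄, c₂]
  · intro x y z v₁ v₂ v₃ hx hy hz hs hne hv
    exact distForm_pos_of_le_half hx hy hz hh0 hgh hg hβ hγ hβ2 hγ2 hs
      (fun h => hne ⟨⟨h.1, h.2.1⟩, h.2.2⟩) hv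
  · rintro ⟨c₁, c₂⟩
    rw [c₁] at hγ2
    rw [c₂] at hβ2
    refine ⟨by rw [c₁, c₂], ?_⟩
    have : sineDist (.mk ℝ a ha) (.mk ℝ b hb) = sineDist (.mk ℝ a ha) (.mk ℝ c hc) :=
      (sq_eq_sq₀ hγ.le hβ.le).1 (by linarith)
    rw [this, c₁]
    linarith

section Centroid

variable {a b c : EuclideanSpace ℝ (Fin 3)} {g : ℝ}

theorem sineDist_centroid (ha : a ≠ 0) (he : a + b + c ≠ 0) (ha1 : ‖a‖ = 1)
    (hn : ‖a + b + c‖ ^ 2 = 3 + 6 * g) (hab : inner ℝ a b = g) (hac : inner ℝ a c = g) :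
    sineDist (.mk ℝ a ha) (.mk ℝ (a + b + c) he) = √(2 * (1 - g) / 3) := by
  have h0 : 0 < 3 + 6 * g := by
    rw [← hn]; have := norm_pos_iff.2 he; positivity
  rw [sineDist_mk, ha1, one_mul, div_pow, hn, inner_add_right, inner_add_right,
    real_inner_self_eq_norm_sq, ha1, hab, hac]
  have h1 : 0 < 1 + 2 * g := by linarith
  congr 1
  rw [show 3 + 6 * g = 3 * (1 + 2 * g) by ring, show 1 ^ 2 + g + g = 1 + 2 * g by ring]
  field_simp
  ring

theorem sumDist_centroid (ha : a ≠ 0) (hb : b ≠ 0) (hc : c ≠ 0) (he : a + b + c ≠ 0)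
    (ha1 : ‖a‖ = 1) (hb1 : ‖b‖ = 1) (hc1 : ‖c‖ = 1) (hab : inner ℝ a b = g)
    (hac : inner ℝ a c = g) (hbc : inner ℝ b c = g) :
    sumDist (.mk ℝ a ha) (.mk ℝ b hb) (.mk ℝ c hc) (.mk ℝ (a + b + c) he)
      = √(6 * (1 - g)) := by
  have hn := norm_sq_add_add_of_equiangular ha1 hb1 hc1 hab hac hbc
  have e₁ : a + b + c = b + a + c := by abel
  have e₂ : a + b + c = c + a + b := by abel
  rw [sumDist, sineDist_centroid ha he ha1 hn hab hac]
  simp only [e₁] at hn ⊢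
  rw [sineDist_centroid hb (e₁ ▸ he) hb1 hn (by rw [real_inner_comm, hab]) hbc]
  rw [← e₁] at hn
  have e₃ : b + a + c = c + a + b := by abel
  rw [e₂] at hn
  simp only [e₃]
  rw [sineDist_centroid hc (e₂ ▸ he) hc1 hn (by rw [real_inner_comm, hac])
    (by rw [real_inner_comm, hbc])]
  rw [show 6 * (1 - g) = 3 ^ 2 * (2 * (1 - g) / 3) by ring,
    Real.sqrt_mul (by norm_num), Real.sqrt_sq (by norm_num)]
  ring

theorem eq_centroid_of_sineDist_eq {P : ProjPlane} (ha : a ≠ 0) (hb : b ≠ 0) (hc : c ≠ 0)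
    (he : a + b + c ≠ 0)
    (ha1 : ‖a‖ = 1) (hb1 : ‖b‖ = 1) (hc1 : ‖c‖ = 1) (hab : inner ℝ a b = g)
    (hac : inner ℝ a c = g) (hbc : inner ℝ b c = g) (hg : 0 < g)
    (h₁ : sineDist (.mk ℝ a ha) P = sineDist (.mk ℝ b hb) P)
    (h₂ : sineDist (.mk ℝ b hb) P = sineDist (.mk ℝ c hc) P)
    (hs : sumDist (.mk ℝ a ha) (.mk ℝ b hb) (.mk ℝ c hc) P ^ 2 = 6 * (1 - g)) :
    P = .mk ℝ (a + b + c) he := by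
  obtain ⟨p, hp, hp1, rfl⟩ := exists_unit_eq_mk P
  have i₁ := sineDist_sq_of_unit ha hp ha1 hp1
  have i₂ := sineDist_sq_of_unit hb hp hb1 hp1
  have i₃ := sineDist_sq_of_unit hc hp hc1 hp1
  rw [sumDist, h₁, h₂] at hs
  rw [h₁, h₂] at i₁
  rw [h₂] at i₂
  rw [Projectivization.mk_eq_mk_iff']
  exact exists_smul_centroid_eq ha1 hb1 hc1 hp1 hab hac hbc hg (by linarith) (by linarith)
    (by linarith)

/-- For equiangular lines with angle less than `60°` the centroid is the only minimizer. -/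
theorem fermatTorricelli_eq_centroid (ha : a ≠ 0) (hb : b ≠ 0) (hc : c ≠ 0) (he : a + b + c ≠ 0)
    (ha1 : ‖a‖ = 1) (hb1 : ‖b‖ = 1) (hc1 : ‖c‖ = 1) (hab : inner ℝ a b = g)
    (hac : inner ℝ a c = g) (hbc : inner ℝ b c = g) (hg : 1 / 2 < g) (hg1 : g < 1) :
    fermatTorricelli (.mk ℝ a ha) (.mk ℝ b hb) (.mk ℝ c hc) = {.mk ℝ (a + b + c) he} := by
  have hF0 : 0 < 6 * (1 - g) := by linarith
  have hF2 : √(6 * (1 - g)) ^ 2 = 6 * (1 - g) := Real.sq_sqrt hF0.le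
  have hFp : 0 < √(6 * (1 - g)) := Real.sqrt_pos.2 hF0
  refine fermatTorricelli_eq (F := √(6 * (1 - g))) (Set.singleton_nonempty _) ?_ ?_
  · rintro P rfl
    exact sumDist_centroid ha hb hc he ha1 hb1 hc1 hab hac hbc
  intro P hP
  rw [Set.mem_singleton_iff]
  have side : ∀ {u v : EuclideanSpace ℝ (Fin 3)} (hu : u ≠ 0) (hv : v ≠ 0), ‖u‖ = 1 → ‖v‖ = 1 →
      inner ℝ u v = g → sineDist (.mk ℝ u hu) (.mk ℝ v hv) = √(1 - g ^ 2) := by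
    intro u v hu hv hu1 hv1 huv
    rw [sineDist_mk, hu1, hv1, huv, mul_one, div_one]
  have dab := side ha hb ha1 hb1 hab
  have dac := side ha hc ha1 hc1 hac
  have dbc := side hb hc hb1 hc1 hbc
  -- The centroid beats the vertices: `6 (1 - g) < 4 (1 - g)(1 + g)` amounts to `g > 1/2`.
  have hlt : √(6 * (1 - g)) < √(1 - g ^ 2) + √(1 - g ^ 2) := by
    rw [← two_mul, Real.sqrt_lt' (by have : 0 < 1 - g ^ 2 := by nlinarith
                                     positivity), mul_pow, Real.sq_sqrt (by nlinarith)]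
    nlinarith
  have hA : P ≠ .mk ℝ a ha := by
    rintro rfl; rw [sumDist_first, dab, dac] at hP; linarith
  have hB : P ≠ .mk ℝ b hb := by
    rintro rfl; rw [sumDist_second, dab, dbc] at hP; linarith
  have hC : P ≠ .mk ℝ c hc := by
    rintro rfl; rw [sumDist_third, dac, dbc] at hP; linarith
  have hx := sineDist_pos hA.symm
  have hy := sineDist_pos hB.symm
  have hz := sineDist_pos hC.symm
  have hga : |g| = g := abs_of_pos (by linarith)
  have key : True ∧ sineDist (.mk ℝ a ha) P = sineDist (.mk ℝ b hb) P ∧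
      sineDist (.mk ℝ b hb) P = sineDist (.mk ℝ c hc) P ∧
      sineDist (.mk ℝ a ha) P + sineDist (.mk ℝ b hb) P + sineDist (.mk ℝ c hc) P
        = √(6 * (1 - g)) ∧ |inner ℝ b c| = g := by
    obtain ⟨p, hp, hp1, rfl⟩ := exists_unit_eq_mk P
    refine eq_of_add_dist_le ha1 hb1 hc1 hp1 (by rw [hab, hga]) (by rw [hac, hga])
      (by rw [hbc, hga]) hx hy hz
      (sineDist_sq_of_unit ha hp ha1 hp1) (sineDist_sq_of_unit hb hp hb1 hp1)
      (sineDist_sq_of_unit hc hp hc1 hp1) (by nlinarith) hP ?_ (fun _ => ⟨rfl, hF2⟩)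
    intro x y z v₁ v₂ v₃ hx hy hz hs hne hv
    exact distForm_pos_of_half_lt hx hy hz hg hg1 hFp hF2 hs (fun h => hne ⟨trivial, h⟩) hv
  obtain ⟨-, e₁, e₂, e₃, -⟩ := key
  refine eq_centroid_of_sineDist_eq ha hb hc he ha1 hb1 hc1 hab hac hbc (by linarith) e₁ e₂ ?_
  rw [sumDist, e₃, hF2]

end Centroid

theorem isCollinear_of_add_add_eq_zero {a b c : EuclideanSpace ℝ (Fin 3)} (ha : a ≠ 0)
    (hb : b ≠ 0) (hc : c ≠ 0) (h : a + b + c = 0) :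
    Projectivization.IsCollinear ({.mk ℝ a ha, .mk ℝ b hb, .mk ℝ c hc} : Set ProjPlane) := by
  refine ⟨(Submodule.span ℝ {a, b}).projectivization, ?_, ?_, ?_⟩
  · rw [Projectivization.Subspace.submodule.apply_symm_apply]
    exact Module.Finite.span_of_finite _ (Set.toFinite _)
  · rw [Projectivization.Subspace.submodule.apply_symm_apply]
    classical
    have := finrank_span_finset_le_card (R := ℝ) ({a, b} : Finset (EuclideanSpace ℝ (Fin 3)))
    rw [Finset.coe_pair] at this
    exact this.trans Finset.card_le_two
  · have h₁ : a ∈ Submodule.span ℝ {a, b} := Submodule.subset_span (by simp)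
    have h₂ : b ∈ Submodule.span ℝ {a, b} := Submodule.subset_span (by simp)
    have h₃ : c ∈ Submodule.span ℝ {a, b} := by
      rw [show c = -(a + b) from eq_neg_of_add_eq_zero_right h]
      exact Submodule.neg_mem _ (Submodule.add_mem _ h₁ h₂)
    rintro P (rfl | rfl | rfl)
    · simpa using h₁
    · simpa using h₂
    · simpa using h₃

/-- Equal angles give inner products equal up to sign; for each sign pattern, negating at most one
vector makes them equal. Non-collinearity keeps the sum nonzero. -/
theorem exists_isCentroidLine {A B C : ProjPlane}
    (hABC : ¬ Projectivization.IsCollinear ({A, B, C} : Set ProjPlane))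
    (h₁ : lineAngle A B = lineAngle A C) (h₂ : lineAngle A C = lineAngle B C) :
    ∃ E, IsCentroidLine A B C E := by
  obtain ⟨a, ha, ha1, rfl⟩ := exists_unit_eq_mk A
  obtain ⟨b, hb, hb1, rfl⟩ := exists_unit_eq_mk B
  obtain ⟨c, hc, hc1, rfl⟩ := exists_unit_eq_mk C
  have k₁ := congrArg Real.cos h₁
  have k₂ := congrArg Real.cos h₂
  rw [cos_lineAngle_of_unit ha hb ha1 hb1, cos_lineAngle_of_unit ha hc ha1 hc1] at k₁
  rw [cos_lineAngle_of_unit hb hc hb1 hc1, cos_lineAngle_of_unit ha hc ha1 hc1] at k₂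
  have flip : ∀ {v : EuclideanSpace ℝ (Fin 3)} (hv : v ≠ 0),
      Projectivization.mk ℝ v hv = .mk ℝ (-v) (neg_ne_zero.2 hv) := by
    intro v hv
    rw [Projectivization.mk_eq_mk_iff']
    exact ⟨-1, by simp⟩
  have main : ∀ {a b c : EuclideanSpace ℝ (Fin 3)} (ha : a ≠ 0) (hb : b ≠ 0) (hc : c ≠ 0),
      ‖a‖ = 1 → ‖b‖ = 1 → ‖c‖ = 1 → inner ℝ a b = inner ℝ a c → inner ℝ a c = inner ℝ b c →
      ¬ Projectivization.IsCollinear ({.mk ℝ a ha, .mk ℝ b hb, .mk ℝ c hc} : Set ProjPlane) →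
      ∃ E, IsCentroidLine (.mk ℝ a ha) (.mk ℝ b hb) (.mk ℝ c hc) E := by
    intro a b c ha hb hc ha1 hb1 hc1 i₁ i₂ hn
    exact ⟨_, a, b, c, ha, hb, hc, fun h => hn (isCollinear_of_add_add_eq_zero ha hb hc h),
      ha1, hb1, hc1, i₁, i₂, rfl, rfl, rfl, rfl⟩
  rcases abs_eq_abs.1 k₁ with i₁ | i₁ <;> rcases abs_eq_abs.1 k₂ with i₂ | i₂
  · exact main ha hb hc ha1 hb1 hc1 i₁ i₂ hABC
  · rw [flip ha] at hABC ⊢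
    exact main _ _ _ (by rwa [norm_neg]) hb1 hc1 (by rw [inner_neg_left, inner_neg_left, i₁])
      (by rw [inner_neg_left, i₂, neg_neg]) hABC
  · rw [flip hc] at hABC ⊢
    exact main _ _ _ ha1 hb1 (by rwa [norm_neg])
      (by rw [inner_neg_right, i₁]) (by rw [inner_neg_right, inner_neg_right, i₂]) hABC
  · rw [flip hb] at hABC ⊢
    exact main _ _ _ ha1 (by rwa [norm_neg]) hc1
      (by rw [inner_neg_right, i₁, neg_neg])
      (by rw [inner_neg_left, i₂]) hABC

end FermatTorricelli

/-! ### The theorem, case by case -/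

theorem theorem1 (A B C : ProjPlane)
    (hABC : ¬ Projectivization.IsCollinear ({A, B, C} : Set ProjPlane))
    (h₁ : lineAngle A B ≤ lineAngle A C) (h₂ : lineAngle A C ≤ lineAngle B C) :
    (Real.pi / 3 ≤ lineAngle A B → lineAngle A C < lineAngle B C →
      fermatTorricelli A B C = {A}) ∧
    (Real.pi / 3 ≤ lineAngle A B → lineAngle A B < lineAngle A C →
      lineAngle A C = lineAngle B C →
      fermatTorricelli A B C = {A, B}) ∧
    (∀ φ : ℝ, lineAngle A B = φ → lineAngle A C = φ → lineAngle B C = φ →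
      (∃ E, IsCentroidLine A B C E) ∧
      ∀ E, IsCentroidLine A B C E →
        (Real.pi / 3 < φ → fermatTorricelli A B C = {A, B, C}) ∧
        (φ = Real.pi / 3 → fermatTorricelli A B C = {A, B, C, E}) ∧
        (φ < Real.pi / 3 → fermatTorricelli A B C = {E})) := by
  have hpi := Real.pi_pos
  have cos_lt : ∀ {P Q R S : ProjPlane}, lineAngle P Q < lineAngle R S →
      Real.cos (lineAngle R S) < Real.cos (lineAngle P Q) := fun {P Q R S} h =>
    Real.cos_lt_cos_of_nonneg_of_le_pi (lineAngle_nonneg P Q) (by linarith [lineAngle_le R S]) h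
  refine ⟨fun h₀ hlt => ?_, fun h₀ hlt heq => ?_, ?_⟩
  · have l₁ := sineDist_lt_of_lineAngle_lt hlt
    have l₂ := sineDist_lt_of_lineAngle_lt (h₁.trans_lt hlt)
    refine fermatTorricelli_eq (F := sineDist A B + sineDist A C) (Set.singleton_nonempty _) ?_ ?_
    · rintro P rfl; exact sumDist_first _ _ _
    · intro P hP
      rcases eq_vertex_or_of_sumDist_le h₁ h₂ h₀ hP with rfl | rfl | rfl | ⟨-, c₁, c₂, -⟩
      · rfl
      · rw [sumDist_second] at hP; linarith
      · rw [sumDist_third] at hP; linarith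
      · have := cos_lt hlt; linarith
  · have e : sineDist A C = sineDist B C := congrArg Real.sin heq
    have l := sineDist_lt_of_lineAngle_lt hlt
    refine fermatTorricelli_eq (F := sineDist A B + sineDist A C) (Set.insert_nonempty _ _) ?_ ?_
    · rintro P (rfl | rfl)
      · exact sumDist_first _ _ _
      · rw [sumDist_second, e]
    · intro P hP
      rcases eq_vertex_or_of_sumDist_le h₁ h₂ h₀ hP with rfl | rfl | rfl | ⟨c₁, c₂, -⟩
      · exact Or.inl rfl
      · exact Or.inr rfl
      · rw [sumDist_third] at hP; linarith
      · have := cos_lt hlt; linarith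
  · intro φ hab hac hbc
    refine ⟨exists_isCentroidLine hABC (hab.trans hac.symm) (hac.trans hbc.symm), ?_⟩
    intro E hE
    have eab : sineDist A B = Real.sin φ := congrArg Real.sin hab
    have eac : sineDist A C = Real.sin φ := congrArg Real.sin hac
    have ebc : sineDist B C = Real.sin φ := congrArg Real.sin hbc
    have sA := sumDist_first A B C
    have sB := sumDist_second A B C
    have sC := sumDist_third A B C
    rw [eab, eac] at sA
    rw [eab, ebc] at sB
    rw [eac, ebc] at sC
    have hneAB : A ≠ B := by
      rintro rfl
      exact hABC (by simpa using Projectivization.isCollinear_pair A C)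
    obtain ⟨a, b, c, ha, hb, hc, he, ha1, hb1, hc1, i₁, i₂, rfl, rfl, rfl, rfl⟩ := hE
    obtain ⟨g, hg⟩ : ∃ g, g = (inner ℝ b c : ℝ) := ⟨_, rfl⟩
    have jbc : inner ℝ b c = g := hg.symm
    have jac : inner ℝ a c = g := i₂.trans jbc
    have jab : inner ℝ a b = g := i₁.trans jac
    have hgcos : Real.cos φ = |g| := by
      rw [← hab, cos_lineAngle_of_unit ha hb ha1 hb1, jab]
    have hφ0 : 0 ≤ φ := hab ▸ lineAngle_nonneg _ _
    have hφ1 : φ ≤ Real.pi / 2 := hab ▸ lineAngle_le _ _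
    -- `0 < ‖a + b + c‖² = 3 + 6 g`. For angles at most `60°`, where `|g| ≥ 1/2`, this excludes
    -- negative `g`.
    have hghalf : -(1 / 2) < g := by
      have := norm_sq_add_add_of_equiangular ha1 hb1 hc1 jab jac jbc
      have := pow_pos (norm_pos_iff.2 he) 2
      linarith
    refine ⟨fun hφ => ?_, fun hφ => ?_, fun hφ => ?_⟩
    · refine fermatTorricelli_eq (F := Real.sin φ + Real.sin φ) (Set.insert_nonempty _ _) ?_ ?_
      · rintro P (rfl | rfl | rfl) <;> assumption
      · intro P hP
        rcases eq_vertex_or_of_sumDist_le h₁ h₂ (by linarith) (by rwa [eab, eac])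
          with rfl | rfl | rfl | ⟨c₁, -⟩
        · exact Or.inl rfl
        · exact Or.inr (Or.inl rfl)
        · exact Or.inr (Or.inr rfl)
        · have := Real.cos_lt_cos_of_nonneg_of_le_pi (by positivity) (by linarith) hφ
          rw [Real.cos_pi_div_three, ← hab] at this
          linarith
    · rw [hφ, Real.cos_pi_div_three] at hgcos
      have hg2 : g = 1 / 2 := by
        rcases abs_cases g with ⟨e, -⟩ | ⟨e, -⟩ <;> linarith
      have hsin : Real.sin φ + Real.sin φ = √(6 * (1 - g)) := by
        rw [hφ, Real.sin_pi_div_three, hg2]; norm_num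
      refine fermatTorricelli_eq (F := Real.sin φ + Real.sin φ) (Set.insert_nonempty _ _) ?_ ?_
      · rintro P (rfl | rfl | rfl | rfl)
        · exact sA
        · exact sB
        · exact sC
        · rw [hsin]; exact sumDist_centroid ha hb hc he ha1 hb1 hc1 jab jac jbc
      · intro P hP
        rcases eq_vertex_or_of_sumDist_le h₁ h₂ (by linarith) (by rwa [eab, eac])
          with rfl | rfl | rfl | ⟨-, -, -, d₁, d₂, d₃⟩
        · exact Or.inl rfl
        · exact Or.inr (Or.inl rfl)
        · exact Or.inr (Or.inr (Or.inl rfl))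
        · refine Or.inr (Or.inr (Or.inr ?_))
          refine eq_centroid_of_sineDist_eq ha hb hc he ha1 hb1 hc1 jab jac jbc (by linarith)
            d₁ d₂ ?_
          rw [d₃, eab, eac, hsin, Real.sq_sqrt (by linarith)]
    · have hlt := Real.cos_lt_cos_of_nonneg_of_le_pi hφ0 (by linarith) hφ
      rw [Real.cos_pi_div_three, hgcos] at hlt
      have hg2 : 1 / 2 < g := by
        rcases abs_cases g with ⟨e, -⟩ | ⟨e, -⟩ <;> linarith
      have hg1 : g < 1 := by
        have := pow_pos (sineDist_pos hneAB) 2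
        rw [sineDist_sq_of_unit ha hb ha1 hb1, jab] at this
        nlinarith
      exact fermatTorricelli_eq_centroid ha hb hc he ha1 hb1 hc1 jab jac jbc hg2 hg1
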